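/- **Theorem (lower bound, unrestricted marginal).** Setting. Let $d\ge 1$. A classification problem $\mathbb P_{X,Y}$ is given by a probability measure $\mathbb P_X$ supported on $[0,1]^d$ and a regression function $\eta:\mathbb R^d\to[0,1]$, where $Y\in\{0,1\}$ and $\mathbb P(Y=1\mid X=x)=\eta(x)$. For a classifier $f$ put $R(f)=\mathbb P_{X,Y}(Y\ne f(X))$ and $\mathcal E_{\mathbb P_{X,Y}}(f)=R(f)-R(f^*)$, where $f^*(x)=\mathbf 1\{\eta(x)\ge 1/2\}$. For $\alpha>0$, $\lambda>0$, let $\Sigma(\lambda,\alpha)$ be the set of $\lfloor\alpha\rfloor$ times continuously differentiable functions $g:\mathbb R^d\to[0,1]$ such that $\sup_x\sum_{|s|=j}|D^sg(x)|\le\lambda$ for every integer $0\le j\le\alpha$, and $\sup_{x\ne y}\sum_{|s|=\lfloor\alpha\rfloor}\frac{|D^sg(x)-D^sg(y)|}{|x-y|_2^{\alpha-\lfloor\alpha\rfloor}}\le\lambda$. Let $\mathcal P(\alpha,\beta,0)=\mathcal P(\alpha,\beta,0;\lambda,c_3)$ be the set of all classification problems with $\eta\in\Sigma(\lambda,\alpha)$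 and $\mathbb P_X(|\eta(X)-1/2|\le\Delta)\le c_3\Delta^\beta$ for all $\Delta>0$. A strategy that samples at most $n$ labels successively chooses at most $n$ points of $\mathbb R^d$, each choice depending on the labels received so far and on a random seed, and then returns a classifier $\widehat f_n$, which also depends on the seed and on the labels received. A request at $x$ is answered by a fresh Bernoulli label with parameter $\eta(x)$. The law of the seed may depend on $\mathbb P_X$ (so that unlabelled draws of $X$, and hence passive strategies, are included), but the seed carries no further information on $\eta$. Claim. Let $\alpha>0$, $\beta\ge0$, and assume that $c_3,\lambda$ are large enough (depending on $d,\alpha,\beta$). Then there are $C>0$ and $N\in\mathbb N$, depending only on $d,\alpha,\beta,\lambda,c_3$, such that for every $n\ge N$, any (possibly active, possibly randomized) strategy that samples at most $n$ labels and returns a classifier $\widehat f_n$ satisfies $$\sup_{\mathbb P_{X,Y}\in\mathcal P(\alpha,\beta,0)}\mathbb E_{\mathbb P_{X,Y}}\big[\mathcal E_{\mathbb P_{X,Y}}(\widehat f_n)\big]\ \ge\ C\,n^{-\frac{\alpha(1+\beta)}{2\alpha+d}}.$$ -/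

import Mathlib

open MeasureTheory ProbabilityTheory

noncomputable section

namespace ActiveLearning

/-- `ℝ^d` with its Euclidean norm. -/
abbrev E (d : ℕ) : Type := EuclideanSpace ℝ (Fin d)

/-- The cube `[0,1]^d`. -/
def unitCube (d : ℕ) : Set (E d) := {x | ∀ i, x i ∈ Set.Icc (0 : ℝ) 1}

/-- The mixed partial derivative `D^s g (x)` for the multi-index `s`: the derivative of order
`|s| = ∑ i, s i`, evaluated at a list of standard basis vectors that contains
the `i`-th one exactly `s i` times. -/
def mixedPartial {d : ℕ} (s : Fin d → ℕ) (g : E d → ℝ) (x : E d) : ℝ :=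
  iteratedFDeriv ℝ (∑ i, s i) g x
    (fun t => EuclideanSpace.single (finSigmaFinEquiv.symm t).1 (1 : ℝ))

/-- The multi-indices `s` with `|s| = j`. -/
def multiIndices (d j : ℕ) : Finset (Fin d → ℕ) := Finset.piAntidiag Finset.univ j

/-- The Hölder class `Σ(lam, α)` of functions `ℝ^d → [0,1]`. -/
structure IsHolder {d : ℕ} (lam α : ℝ) (g : E d → ℝ) : Prop where
  mem_Icc : ∀ x, g x ∈ Set.Icc (0 : ℝ) 1
  contDiff : ContDiff ℝ ((⌊α⌋₊ : ℕ) : WithTop ℕ∞) g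
  deriv_le : ∀ j : ℕ, (j : ℝ) ≤ α → ∀ x,
    ∑ s ∈ multiIndices d j, |mixedPartial s g x| ≤ lam
  holder_le : ∀ x y, x ≠ y →
    ∑ s ∈ multiIndices d ⌊α⌋₊,
      |mixedPartial s g x - mixedPartial s g y| / ‖x - y‖ ^ (α - (⌊α⌋₊ : ℝ)) ≤ lam

/-- A binary classification problem: the marginal law of `X`, supported on `[0,1]^d`, and the
regression function `η(x) = P(Y = 1 | X = x)`, extended to the whole of `ℝ^d`.
The label `1` is `true`, the label `0` is `false`. -/
structure Problem (d : ℕ) where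
  marginal : Measure (E d)
  isProb : IsProbabilityMeasure marginal
  supported : marginal (unitCube d)ᶜ = 0
  η : E d → ℝ
  measurable_η : Measurable η
  η_mem : ∀ x, η x ∈ Set.Icc (0 : ℝ) 1

namespace Problem

variable {d : ℕ} (P : Problem d)

instance : IsProbabilityMeasure P.marginal := P.isProb

/-- The conditional law of `Y` given `X = x`: Bernoulli with parameter `η x`. -/
def labelKernel : Kernel (E d) Bool where
  toFun x := ENNReal.ofReal (P.η x) • Measure.dirac true
    + ENNReal.ofReal (1 - P.η x) • Measure.dirac false
  measurable' := by
    refine Measure.measurable_of_measurable_coe _ fun s _ => ?_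
    simp only [Measure.coe_add, Measure.coe_smul, Pi.add_apply, Pi.smul_apply, smul_eq_mul]
    have h := P.measurable_η
    fun_prop

instance : IsMarkovKernel P.labelKernel where
  isProbabilityMeasure x := by
    constructor
    change (ENNReal.ofReal (P.η x) • Measure.dirac true
      + ENNReal.ofReal (1 - P.η x) • Measure.dirac false : Measure Bool) Set.univ = 1
    have h := P.η_mem x
    simp [← ENNReal.ofReal_add h.1 (sub_nonneg.2 h.2)]

/-- The law of `(X, Y)`. -/
def jointLaw : Measure (E d × Bool) := P.marginal ⊗ₘ P.labelKernel

/-- The `0`-`1` risk `R(f) = P(Y ≠ f(X))`. -/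
def risk (f : E d → Bool) : ℝ := P.jointLaw.real {z | z.2 ≠ f z.1}

open Classical in
/-- The Bayes classifier `1{η ≥ 1/2}`. -/
def bayes : E d → Bool := fun x => decide (1 / 2 ≤ P.η x)

/-- The excess risk of a classifier. -/
def excessRisk (f : E d → Bool) : ℝ := P.risk f - P.risk P.bayes

/-- The margin condition with parameters `β`, `Δ₀`, `c₃`. -/
def Margin (β Δ₀ c₃ : ℝ) : Prop :=
  P.marginal {x | |P.η x - 1 / 2| < Δ₀} = 0 ∧
  ∀ Δ : ℝ, 0 < Δ → P.marginal.real {x | |P.η x - 1 / 2| ≤ Δ₀ + Δ} ≤ c₃ * Δ ^ β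

end Problem

/-- The class `𝒫(α, β, Δ₀; lam, c₃)`, without restriction on the marginal. -/
def problemClass (d : ℕ) (α β Δ₀ lam c₃ : ℝ) : Set (Problem d) :=
  {P | IsHolder lam α P.η ∧ P.Margin β Δ₀ c₃}

/-- A deterministic adaptive sampling rule: either stop and return a (measurable) classifier, or
request a label at a point of `ℝ^d` and continue according to the label received. -/
inductive QueryTree (d : ℕ) : Type
  | output (f : E d → Bool) (hf : Measurable f) : QueryTree d
  | query (x : E d) (next : Bool → QueryTree d) : QueryTree d

namespace QueryTree

variable {d : ℕ}

/-- The largest number of labels that the rule may request. -/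
def depth : QueryTree d → ℕ
  | output _ _ => 0
  | query _ next => 1 + max (depth (next true)) (depth (next false))

/-- Expected excess risk of the returned classifier, when every request at `x` is answered by
a fresh Bernoulli label with parameter `η x`. -/
def expectedExcessRisk (P : Problem d) : QueryTree d → ℝ
  | output f _ => P.excessRisk f
  | query x next => P.η x * expectedExcessRisk P (next true)
      + (1 - P.η x) * expectedExcessRisk P (next false)

end QueryTree

/-- A (possibly randomized, possibly active) strategy: it draws a seed `ω`, then follows the
adaptive rule `rule ω`. The law of the seed may depend on the marginal law of `X`, so the seed may
contain unlabelled draws of `X` (as it does for passive learners) besides internal randomness;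
it carries no information on the labels. The last field only says that the expected
excess risk is well defined. -/
structure Strategy (d : ℕ) (Ω : Type*) [MeasurableSpace Ω] where
  seedLaw : Measure (E d) → Measure Ω
  isProb : ∀ μ : Measure (E d), IsProbabilityMeasure μ → IsProbabilityMeasure (seedLaw μ)
  rule : Ω → QueryTree d
  aemeasurable : ∀ P : Problem d,
    AEMeasurable (fun ω => (rule ω).expectedExcessRisk P) (seedLaw P.marginal)

namespace Strategy

variable {d : ℕ} {Ω : Type*} [MeasurableSpace Ω] (S : Strategy d Ω)

/-- The strategy never requests more than `n` labels. -/
def HasBudget (n : ℕ) : Prop := ∀ ω, (S.rule ω).depth ≤ n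

/-- The expected excess risk of the classifier returned by the strategy. -/
def expectedExcessRisk (P : Problem d) : ℝ :=
  ∫ ω, (S.rule ω).expectedExcessRisk P ∂(S.seedLaw P.marginal)

end Strategy

end ActiveLearning

end

/-! Around `1/2`, put `q ^ d` disjoint bumps of height `h` of order `q ^ (-α)` on a grid, with
unknown signs. The marginal spreads mass `h ^ β` evenly over their centres and puts the rest at a
far corner, where `η = 5/8`. The margin condition tolerates this mass, and each wrong sign costs `2
* h * h ^ β / q ^ d`. If a constant fraction of the signs stays unknown, the excess risk is of order
`h ^ (1 + β)`, which is the claimed rate for `q` of order `n ^ (1 / (2 * α + d))`.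

That the signs stay unknown is a Bayesian argument that adaptivity does not affect. Give the signs a
product prior. The law of a label at any point depends on one sign only, so the posterior is again a
product and a single parameter moves (`prodBern_mul_ite`). The potential `∑ p k * (1 - p k)` drops
in expectation by at most `δ ^ 2 / 3` per label, with `δ = 2 * h` (`posterior_variance`). At the
end, sign `k` is missed with posterior probability at least `min (p k) (1 - p k) ≥ p k * (1 - p k)`.
Induction on the query tree gives `QueryTree.le_sum_prodBern`. The potential starts at `q ^ d / 4`,
and `n ≤ q ^ (2 * α + d)` labels remove only a small part of it. The problems share their marginal,
hence the law of the seed, so the average over signs passes through the seed and is at most the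
supremum. -/

namespace ActiveLearning

/-! ### Product priors on signs and their Bayesian update -/

section Prior

variable {K : Type*} [Fintype K]

/-- The mass that the Bernoulli law with parameter `p` gives to a label. -/
def bern (p : ℝ) (b : Bool) : ℝ := if b then p else 1 - p

/-- The mass function of a product of Bernoulli laws. -/
def prodBern (p : K → ℝ) (σ : K → Bool) : ℝ := ∏ k, bern (p k) (σ k)

lemma prodBern_nonneg {p : K → ℝ} (hp : ∀ k, p k ∈ Set.Icc (0 : ℝ) 1) (σ : K → Bool) :
    0 ≤ prodBern p σ := by
  refine Finset.prod_nonneg fun k _ => ?_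
  have := hp k
  unfold bern
  split_ifs
  · exact this.1
  · exact sub_nonneg.2 this.2

variable [DecidableEq K]

/-- Once `g (σ k)` is absorbed into the `k`-th factor, the sum of products factorizes, and every
other coordinate sums to `1`. -/
lemma sum_prodBern_mul (p : K → ℝ) (k : K) (g : Bool → ℝ) :
    ∑ σ, prodBern p σ * g (σ k) = p k * g true + (1 - p k) * g false := by
  have h : ∀ σ : K → Bool, prodBern p σ * g (σ k)
      = ∏ j, (bern (p j) (σ j) * if j = k then g (σ j) else 1) := by
    intro σ
    rw [Finset.prod_mul_distrib, Finset.prod_ite_eq' Finset.univ k (fun j => g (σ j))]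
    simp [prodBern]
  simp_rw [h]
  have := Finset.prod_univ_sum (fun _ : K => (Finset.univ : Finset Bool))
    (fun j b => bern (p j) b * if j = k then g b else 1)
  rw [Fintype.piFinset_univ] at this
  rw [← this, Finset.prod_eq_single k]
  · simp [bern]
  · intro j _ hj
    simp [bern, hj]
  · simp

lemma sum_prodBern (p : K → ℝ) [Nonempty K] : ∑ σ, prodBern p σ = 1 := by
  have := sum_prodBern_mul p (Classical.arbitrary K) (fun _ => 1)
  simpa using this

lemma prodBern_update (p : K → ℝ) (k : K) (a : ℝ) (σ : K → Bool) :
    prodBern (Function.update p k a) σ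
      = bern a (σ k) * ∏ j ∈ Finset.univ.erase k, bern (p j) (σ j) := by
  unfold prodBern
  rw [← Finset.mul_prod_erase _ _ (Finset.mem_univ k), Function.update_self]
  congr 1
  refine Finset.prod_congr rfl fun j hj => ?_
  rw [Function.update_of_ne (Finset.ne_of_mem_erase hj)]

/-- Bayes' rule: conditioning a product law on a label that depends on one coordinate. -/
lemma prodBern_mul_ite (p : K → ℝ) (k : K) {A B D : ℝ} (hD : D ≠ 0)
    (h : D = p k * A + (1 - p k) * B) (σ : K → Bool) :
    prodBern p σ * (if σ k then A else B)
      = D * prodBern (Function.update p k (p k * A / D)) σ := by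
  rw [prodBern_update]
  have h' : 1 - p k * A / D = (1 - p k) * B / D := by
    rw [h] at hD ⊢
    field_simp
    ring
  unfold prodBern
  rw [← Finset.mul_prod_erase _ _ (Finset.mem_univ k)]
  cases hσ : σ k
  · simp only [bern, Bool.false_eq_true, if_false, h']
    field_simp
  · simp only [bern, if_true]
    field_simp

lemma sum_update_mul_one_sub (p : K → ℝ) (k : K) (a : ℝ) :
    ∑ j, Function.update p k a j * (1 - Function.update p k a j)
      = ∑ j, p j * (1 - p j) + (a * (1 - a) - p k * (1 - p k)) := by
  rw [← Finset.add_sum_erase _ _ (Finset.mem_univ k),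
    ← Finset.add_sum_erase _ (fun j => p j * (1 - p j)) (Finset.mem_univ k), Function.update_self]
  have : ∑ x ∈ Finset.univ.erase k, Function.update p k a x * (1 - Function.update p k a x)
      = ∑ x ∈ Finset.univ.erase k, p x * (1 - p x) :=
    Finset.sum_congr rfl fun j hj => by
      rw [Function.update_of_ne (Finset.ne_of_mem_erase hj)]
  rw [this]
  ring

/-- One label lowers the expected posterior variance by at most `(A - B) ^ 2 / 3`. -/
lemma posterior_variance {p A B D δ : ℝ} (hp : p ∈ Set.Icc (0 : ℝ) 1)
    (hD : D = p * A + (1 - p) * B) (h1 : 1 / 4 ≤ D) (h2 : D ≤ 3 / 4) (hδ : |A - B| ≤ δ) :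
    p * (1 - p) - δ ^ 2 / 3 ≤
      D * (p * A / D * (1 - p * A / D))
        + (1 - D) * (p * (1 - A) / (1 - D) * (1 - p * (1 - A) / (1 - D))) := by
  have hD0 : 0 < D := by linarith
  have hD1 : 0 < 1 - D := by linarith
  -- The exact loss of variance. Below, `(p * (1 - p)) ^ 2 ≤ 1 / 16` and `D * (1 - D) ≥ 3 / 16` give
  -- the factor `1 / 3`.
  have key : D * (p * A / D * (1 - p * A / D))
        + (1 - D) * (p * (1 - A) / (1 - D) * (1 - p * (1 - A) / (1 - D)))
      = p * (1 - p) - (p * (1 - p)) ^ 2 * (A - B) ^ 2 / (D * (1 - D)) := by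
    have e1 : 1 - p * A / D = (1 - p) * B / D := by
      field_simp; rw [hD]; ring
    have e2 : 1 - p * (1 - A) / (1 - D) = (1 - p) * (1 - B) / (1 - D) := by
      field_simp; rw [hD]; ring
    rw [e1, e2]
    field_simp
    rw [hD]
    ring
  rw [key]
  have h3 : (3 : ℝ) / 16 ≤ D * (1 - D) := by nlinarith
  have h4 : p * (1 - p) ≤ 1 / 4 := by nlinarith [sq_nonneg (p - 1 / 2)]
  have h5 : 0 ≤ p * (1 - p) := mul_nonneg hp.1 (by linarith [hp.2])
  have h6 : (A - B) ^ 2 ≤ δ ^ 2 := sq_le_sq' (by linarith [neg_abs_le (A - B)])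
    (le_trans (le_abs_self _) hδ)
  have h7 : (p * (1 - p)) ^ 2 ≤ 1 / 16 := by nlinarith
  have h8 : (p * (1 - p)) ^ 2 * (A - B) ^ 2 ≤ 1 / 16 * δ ^ 2 :=
    mul_le_mul h7 h6 (sq_nonneg _) (by norm_num)
  have : (p * (1 - p)) ^ 2 * (A - B) ^ 2 / (D * (1 - D)) ≤ δ ^ 2 / 3 := by
    rw [div_le_iff₀ (by linarith)]
    nlinarith [sq_nonneg δ]
  linarith

end Prior

/-! ### Boundedness and integrability of the excess risk -/

variable {d : ℕ}

lemma Problem.risk_mem (P : Problem d) (f : E d → Bool) : P.risk f ∈ Set.Icc (0 : ℝ) 1 := by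
  have : IsProbabilityMeasure P.jointLaw := by unfold Problem.jointLaw; infer_instance
  exact ⟨measureReal_nonneg, measureReal_le_one⟩

lemma Problem.abs_excessRisk_le (P : Problem d) (f : E d → Bool) : |P.excessRisk f| ≤ 1 := by
  have h1 := P.risk_mem f
  have h2 := P.risk_mem P.bayes
  unfold Problem.excessRisk
  rw [abs_le]
  constructor <;> linarith [h1.1, h1.2, h2.1, h2.2]

lemma QueryTree.abs_expectedExcessRisk_le (P : Problem d) (T : QueryTree d) :
    |T.expectedExcessRisk P| ≤ 1 := by
  induction T with
  | output f hf => exact P.abs_excessRisk_le f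
  | query x next ih =>
    have h := P.η_mem x
    have h1 := abs_le.1 (ih true)
    have h2 := abs_le.1 (ih false)
    simp only [QueryTree.expectedExcessRisk]
    rw [abs_le]
    constructor <;> nlinarith [h.1, h.2, h1.1, h1.2, h2.1, h2.2]

lemma Strategy.integrable_expectedExcessRisk {Ω : Type*} [MeasurableSpace Ω] (S : Strategy d Ω)
    (P : Problem d) :
    Integrable (fun ω => (S.rule ω).expectedExcessRisk P) (S.seedLaw P.marginal) := by
  have := S.isProb P.marginal P.isProb
  exact Integrable.of_bound (S.aemeasurable P).aestronglyMeasurable 1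
    (Filter.Eventually.of_forall fun ω => (S.rule ω).abs_expectedExcessRisk_le P)

lemma Strategy.expectedExcessRisk_le_one {Ω : Type*} [MeasurableSpace Ω] (S : Strategy d Ω)
    (P : Problem d) : S.expectedExcessRisk P ≤ 1 := by
  have := S.isProb P.marginal P.isProb
  have := integral_mono (S.integrable_expectedExcessRisk P) (integrable_const (1 : ℝ))
    (fun ω => (abs_le.1 ((S.rule ω).abs_expectedExcessRisk_le P)).2)
  simpa [Strategy.expectedExcessRisk] using this

/-! ### Average excess risk of an adaptive rule under the prior -/

section Bayes

variable {K : Type*} [Fintype K] [DecidableEq K]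

/-- Under a product prior on the signs, the average excess risk of a sampling rule is bounded from
below by the prior variance minus what its labels can reveal. -/
lemma QueryTree.le_sum_prodBern (P : (K → Bool) → Problem d) {c δ : ℝ} (hc : 0 ≤ c) (pt : K → E d)
    (hη : ∀ x, ∃ k, ∃ A ∈ Set.Icc (1 / 4 : ℝ) (3 / 4), ∃ B ∈ Set.Icc (1 / 4 : ℝ) (3 / 4),
      |A - B| ≤ δ ∧ ∀ σ, (P σ).η x = if σ k then A else B)
    (hleaf : ∀ σ f, Measurable f →
      c * ∑ k, (if f (pt k) = σ k then 0 else 1) ≤ (P σ).excessRisk f)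
    (T : QueryTree d) (p : K → ℝ) (hp : ∀ k, p k ∈ Set.Icc (0 : ℝ) 1) :
    c * (∑ k, p k * (1 - p k) - T.depth * (δ ^ 2 / 3))
      ≤ ∑ σ, prodBern p σ * T.expectedExcessRisk (P σ) := by
  -- The prior must vary, since the subtrees are analysed under the two posteriors.
  induction T generalizing p with
  | output f hf =>
    simp only [QueryTree.depth, QueryTree.expectedExcessRisk, Nat.cast_zero, zero_mul, sub_zero]
    calc c * ∑ k, p k * (1 - p k)
        ≤ c * ∑ k, ∑ σ, prodBern p σ * (if f (pt k) = σ k then 0 else 1) := by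
          refine mul_le_mul_of_nonneg_left (Finset.sum_le_sum fun k _ => ?_) hc
          rw [sum_prodBern_mul p k (fun b => if f (pt k) = b then 0 else 1)]
          have h := hp k
          -- Either guess is wrong with probability `p k` or `1 - p k`, and both are at least `p k *
          -- (1 - p k)`.
          cases f (pt k) <;> simp <;> nlinarith [h.1, h.2]
      _ = ∑ σ, prodBern p σ * (c * ∑ k, (if f (pt k) = σ k then 0 else 1)) := by
          rw [Finset.sum_comm, Finset.mul_sum]
          refine Finset.sum_congr rfl fun σ _ => ?_
          rw [← Finset.mul_sum]
          ring
      _ ≤ _ := Finset.sum_le_sum fun σ _ =>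
          mul_le_mul_of_nonneg_left (hleaf σ f hf) (prodBern_nonneg hp σ)
  | query x next ih =>
    obtain ⟨k, A, hA, B, hB, hAB, hx⟩ := hη x
    have hk := hp k
    set D := p k * A + (1 - p k) * B with hD
    have hD1 : 1 / 4 ≤ D := by nlinarith [hk.1, hk.2, hA.1, hB.1]
    have hD2 : D ≤ 3 / 4 := by nlinarith [hk.1, hk.2, hA.2, hB.2]
    have hD' : 1 - D = p k * (1 - A) + (1 - p k) * (1 - B) := by rw [hD]; ring
    -- `D` is the predictive probability of the label `true`; for `false`, all of `A`, `B`, `D` are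
    -- replaced by their complements to `1`.
    have e1 := prodBern_mul_ite p k (D := D) (by linarith) hD
    have e2 := prodBern_mul_ite p k (D := 1 - D) (by linarith) hD'
    have upd : ∀ a ∈ Set.Icc (0 : ℝ) 1, ∀ j, Function.update p k a j ∈ Set.Icc (0 : ℝ) 1 := by
      intro a ha j
      by_cases h : j = k
      · subst h; simpa using ha
      · simpa [Function.update_of_ne h] using hp j
    have m1 : p k * A / D ∈ Set.Icc (0 : ℝ) 1 := by
      refine ⟨div_nonneg (mul_nonneg hk.1 (by linarith [hA.1])) (by linarith), ?_⟩
      rw [div_le_one (by linarith)]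
      nlinarith [hk.2, hB.1]
    have m2 : p k * (1 - A) / (1 - D) ∈ Set.Icc (0 : ℝ) 1 := by
      refine ⟨div_nonneg (mul_nonneg hk.1 (by linarith [hA.2])) (by linarith), ?_⟩
      rw [div_le_one (by linarith), hD']
      nlinarith [hk.2, hB.2]
    have i1 := ih true _ (upd _ m1)
    have i2 := ih false _ (upd _ m2)
    rw [sum_update_mul_one_sub] at i1 i2
    have hpost := posterior_variance hk hD hD1 hD2 hAB
    have split : ∑ σ, prodBern p σ * (QueryTree.query x next).expectedExcessRisk (P σ)
        = D * ∑ σ, prodBern (Function.update p k (p k * A / D)) σ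
              * (next true).expectedExcessRisk (P σ)
          + (1 - D) * ∑ σ, prodBern (Function.update p k (p k * (1 - A) / (1 - D))) σ
              * (next false).expectedExcessRisk (P σ) := by
      rw [Finset.mul_sum, Finset.mul_sum, ← Finset.sum_add_distrib]
      refine Finset.sum_congr rfl fun σ _ => ?_
      rw [← mul_assoc, ← mul_assoc, ← e1 σ, ← e2 σ]
      simp only [QueryTree.expectedExcessRisk, hx σ]
      split_ifs <;> ring
    rw [split]
    have d1 : ((next true).depth : ℝ) + 1 ≤ ((QueryTree.query x next).depth : ℝ) := by
      have : (next true).depth + 1 ≤ (QueryTree.query x next).depth := by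
        simp only [QueryTree.depth]; omega
      exact_mod_cast this
    have d2 : ((next false).depth : ℝ) + 1 ≤ ((QueryTree.query x next).depth : ℝ) := by
      have : (next false).depth + 1 ≤ (QueryTree.query x next).depth := by
        simp only [QueryTree.depth]; omega
      exact_mod_cast this
    set N : ℝ := ((QueryTree.query x next).depth : ℝ)
    have hδ : 0 ≤ δ ^ 2 / 3 := by positivity
    refine le_trans ?_ (add_le_add (mul_le_mul_of_nonneg_left i1 (by linarith : 0 ≤ D))
      (mul_le_mul_of_nonneg_left i2 (by linarith : 0 ≤ 1 - D)))
    -- Both branches have at most `N - 1` labels left; the label just spent pays for the variance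
    -- lost in `hpost`.
    have f1 : D * ((next true).depth * (δ ^ 2 / 3)) ≤ D * ((N - 1) * (δ ^ 2 / 3)) := by
      gcongr
      linarith
    have f2 : (1 - D) * ((next false).depth * (δ ^ 2 / 3)) ≤ (1 - D) * ((N - 1) * (δ ^ 2 / 3)) := by
      gcongr
      · linarith
      · linarith
    rw [mul_left_comm, mul_left_comm (1 - D) c, ← mul_add]
    refine mul_le_mul_of_nonneg_left ?_ hc
    linarith

/-- A family of problems indexed by signs, with a common marginal, whose labels reveal one sign at
a time, contains a problem on which a given strategy has large expected excess risk. -/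
lemma Strategy.le_of_forall_expectedExcessRisk_le [Nonempty K] {Ω : Type*} [MeasurableSpace Ω]
    (S : Strategy d Ω) {n : ℕ} (hS : S.HasBudget n)
    (P : (K → Bool) → Problem d) {c δ b : ℝ} (hc : 0 ≤ c) (pt : K → E d)
    (μ : Measure (E d)) (hμ : ∀ σ, (P σ).marginal = μ)
    (hη : ∀ x, ∃ k, ∃ A ∈ Set.Icc (1 / 4 : ℝ) (3 / 4), ∃ B ∈ Set.Icc (1 / 4 : ℝ) (3 / 4),
      |A - B| ≤ δ ∧ ∀ σ, (P σ).η x = if σ k then A else B)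
    (hleaf : ∀ σ f, Measurable f →
      c * ∑ k, (if f (pt k) = σ k then 0 else 1) ≤ (P σ).excessRisk f)
    (hb : ∀ σ, S.expectedExcessRisk (P σ) ≤ b) :
    c * (Fintype.card K / 4 - n * (δ ^ 2 / 3)) ≤ b := by
  -- Fair signs maximize the initial potential, at `1 / 4` per sign.
  let p : K → ℝ := fun _ => 1 / 2
  have hp : ∀ k, p k ∈ Set.Icc (0 : ℝ) 1 := fun k => by constructor <;> norm_num [p]
  have : IsProbabilityMeasure (S.seedLaw μ) := by
    have h := hμ (fun _ => true)
    rw [← h]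
    exact S.isProb _ (P _).isProb
  have hint : ∀ σ, Integrable (fun ω => (S.rule ω).expectedExcessRisk (P σ)) (S.seedLaw μ) :=
    fun σ => hμ σ ▸ S.integrable_expectedExcessRisk (P σ)
  calc c * (Fintype.card K / 4 - n * (δ ^ 2 / 3))
      = ∫ _, c * (Fintype.card K / 4 - n * (δ ^ 2 / 3)) ∂(S.seedLaw μ) := by simp
    _ ≤ ∫ ω, ∑ σ, prodBern p σ * (S.rule ω).expectedExcessRisk (P σ) ∂(S.seedLaw μ) := by
        refine integral_mono (integrable_const _)
          (integrable_finsetSum _ fun σ _ => (hint σ).const_mul _) fun ω => ?_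
        refine le_trans ?_ ((S.rule ω).le_sum_prodBern P hc pt hη hleaf p hp)
        refine mul_le_mul_of_nonneg_left ?_ hc
        have h1 : ∑ k, p k * (1 - p k) = Fintype.card K / 4 := by
          simp [p]
          ring
        have h2 : ((S.rule ω).depth : ℝ) ≤ n := by exact_mod_cast hS ω
        rw [h1]
        gcongr
    _ = ∑ σ, prodBern p σ * S.expectedExcessRisk (P σ) := by
        rw [integral_finsetSum _ fun σ _ => (hint σ).const_mul _]
        refine Finset.sum_congr rfl fun σ _ => ?_
        rw [integral_const_mul, Strategy.expectedExcessRisk, hμ σ]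
    _ ≤ ∑ σ, prodBern p σ * b := Finset.sum_le_sum fun σ _ =>
        mul_le_mul_of_nonneg_left (hb σ) (prodBern_nonneg hp σ)
    _ = b := by rw [← Finset.sum_mul, sum_prodBern, one_mul]

end Bayes

/-! ### Discrete marginals and the excess risk -/

section Discrete

variable {I : Type*} [Fintype I]

/-- The measure with mass `w i` at the point `z i`. -/
noncomputable def discreteMeasure (w : I → ℝ) (z : I → E d) : Measure (E d) :=
  ∑ i, ENNReal.ofReal (w i) • Measure.dirac (z i)

lemma integral_discreteMeasure {w : I → ℝ} (hw : ∀ i, 0 ≤ w i) (z : I → E d) (g : E d → ℝ) :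
    ∫ x, g x ∂(discreteMeasure w z) = ∑ i, w i * g (z i) := by
  unfold discreteMeasure
  rw [integral_finsetSum_measure]
  · refine Finset.sum_congr rfl fun i _ => ?_
    rw [integral_smul_measure, integral_dirac, ENNReal.toReal_ofReal (hw i), smul_eq_mul]
  · intro i _
    exact (integrable_dirac (by simp [enorm_lt_top])).smul_measure ENNReal.ofReal_ne_top

lemma discreteMeasure_apply (w : I → ℝ) (z : I → E d) (s : Set (E d)) :
    discreteMeasure w z s = ∑ i, ENNReal.ofReal (w i) * s.indicator 1 (z i) := by
  simp [discreteMeasure, Measure.finsetSum_apply]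

lemma discreteMeasure_real_apply {w : I → ℝ} (hw : ∀ i, 0 ≤ w i) (z : I → E d) (s : Set (E d)) :
    (discreteMeasure w z).real s = ∑ i, w i * s.indicator 1 (z i) := by
  rw [Measure.real, discreteMeasure_apply, ENNReal.toReal_sum]
  · refine Finset.sum_congr rfl fun i _ => ?_
    by_cases h : z i ∈ s <;> simp [h, hw i]
  · intro i _
    by_cases h : z i ∈ s <;> simp [h]

lemma discreteMeasure_eq_zero (w : I → ℝ) {z : I → E d} {s : Set (E d)} (h : ∀ i, z i ∉ s) :
    discreteMeasure w z s = 0 := by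
  simp [discreteMeasure_apply, h]

lemma isProbabilityMeasure_discreteMeasure {w : I → ℝ} (hw : ∀ i, 0 ≤ w i) (h : ∑ i, w i = 1)
    (z : I → E d) : IsProbabilityMeasure (discreteMeasure w z) := by
  constructor
  rw [discreteMeasure_apply]
  simp only [Set.indicator_univ, Pi.one_apply, mul_one]
  rw [← ENNReal.ofReal_sum_of_nonneg fun i _ => hw i, h, ENNReal.ofReal_one]

end Discrete

/-- Disintegration over `X`: given `X = x`, the label disagrees with `true` with probability `1 - η
x` and with `false` with probability `η x`. -/
lemma Problem.risk_eq (P : Problem d) {f : E d → Bool} (hf : Measurable f) :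
    P.risk f = ∫ x, (if f x then 1 - P.η x else P.η x) ∂P.marginal := by
  have hs : MeasurableSet {z : E d × Bool | z.2 ≠ f z.1} :=
    (measurableSet_eq_fun measurable_snd (hf.comp measurable_fst)).compl
  have hm : Measurable fun x => if f x then 1 - P.η x else P.η x :=
    Measurable.ite (hf (measurableSet_singleton true)) (measurable_const.sub P.measurable_η)
      P.measurable_η
  have hn : ∀ x, 0 ≤ if f x then 1 - P.η x else P.η x := by
    intro x
    have := P.η_mem x
    split_ifs
    · linarith [this.2]
    · exact this.1
  unfold Problem.risk Problem.jointLaw Measure.real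
  rw [Measure.compProd_apply hs, integral_eq_lintegral_of_nonneg_ae (Filter.Eventually.of_forall hn)
    hm.aestronglyMeasurable]
  congr 1
  refine lintegral_congr fun x => ?_
  change (ENNReal.ofReal (P.η x) • Measure.dirac true
      + ENNReal.ofReal (1 - P.η x) • Measure.dirac false : Measure Bool) _ = _
  cases h : f x <;> simp [h]

lemma Problem.measurable_bayes (P : Problem d) : Measurable P.bayes := by
  refine measurable_to_bool ?_
  have : P.bayes ⁻¹' {true} = {x | 1 / 2 ≤ P.η x} := by
    ext x
    simp [Problem.bayes]
  rw [this]
  exact measurableSet_le measurable_const P.measurable_η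

/-- The excess risk of a classifier when the marginal is discrete. -/
lemma Problem.excessRisk_eq_sum {I : Type*} [Fintype I] (P : Problem d) {w : I → ℝ}
    (hw : ∀ i, 0 ≤ w i) {z : I → E d} (hP : P.marginal = discreteMeasure w z)
    {f : E d → Bool} (hf : Measurable f) :
    P.excessRisk f = ∑ i, w i * if f (z i) = P.bayes (z i) then 0 else 2 * |P.η (z i) - 1 / 2| := by
  unfold Problem.excessRisk
  rw [P.risk_eq hf, P.risk_eq P.measurable_bayes, hP, integral_discreteMeasure hw,
    integral_discreteMeasure hw, ← Finset.sum_sub_distrib]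
  refine Finset.sum_congr rfl fun i _ => ?_
  rw [← mul_sub]
  congr 1
  by_cases h : 1 / 2 ≤ P.η (z i)
  · have hb : P.bayes (z i) = true := by simpa [Problem.bayes] using h
    rw [hb, abs_of_nonneg (by linarith)]
    cases f (z i) <;> simp <;> ring
  · have hb : P.bayes (z i) = false := by simpa [Problem.bayes] using h
    rw [hb, abs_of_neg (by linarith)]
    cases f (z i) <;> simp <;> ring

/-! ### Hölder bounds in operator norm and under rescaling -/

section Hoelder

/-- Bounds, in operator norm, for the derivatives of order at most `α` and for the Hölder quotient
of the derivative of order `⌊α⌋`. -/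
structure HolderBound (α M : ℝ) (g : E d → ℝ) : Prop where
  contDiff : ContDiff ℝ ((⌊α⌋₊ : ℕ) : WithTop ℕ∞) g
  norm_le : ∀ j : ℕ, j ≤ ⌊α⌋₊ → ∀ x, ‖iteratedFDeriv ℝ j g x‖ ≤ M
  norm_sub_le : ∀ x y, ‖iteratedFDeriv ℝ ⌊α⌋₊ g x - iteratedFDeriv ℝ ⌊α⌋₊ g y‖
    ≤ M * ‖x - y‖ ^ (α - (⌊α⌋₊ : ℝ))

lemma HolderBound.add {α M M' : ℝ} {g g' : E d → ℝ} (h : HolderBound α M g)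
    (h' : HolderBound α M' g') : HolderBound α (M + M') (fun x => g x + g' x) := by
  have key : ∀ j : ℕ, j ≤ ⌊α⌋₊ → ∀ x, iteratedFDeriv ℝ j (fun x => g x + g' x) x
      = iteratedFDeriv ℝ j g x + iteratedFDeriv ℝ j g' x := by
    intro j hj x
    have hj' : ((j : ℕ) : WithTop ℕ∞) ≤ ((⌊α⌋₊ : ℕ) : WithTop ℕ∞) := by exact_mod_cast hj
    exact iteratedFDeriv_add_apply (h.contDiff.of_le hj').contDiffAt
      (h'.contDiff.of_le hj').contDiffAt
  refine ⟨h.contDiff.add h'.contDiff, fun j hj x => ?_, fun x y => ?_⟩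
  · rw [key j hj]
    exact (norm_add_le _ _).trans (add_le_add (h.norm_le j hj x) (h'.norm_le j hj x))
  · rw [key _ le_rfl, key _ le_rfl, add_sub_add_comm, add_mul]
    exact (norm_add_le _ _).trans (add_le_add (h.norm_sub_le x y) (h'.norm_sub_le x y))

lemma holderBound_const {α c : ℝ} : HolderBound α |c| (fun _ : E d => c) := by
  have key : ∀ (j : ℕ) (x : E d), ‖iteratedFDeriv ℝ j (fun _ : E d => c) x‖ ≤ |c| := by
    intro j x
    rcases Nat.eq_zero_or_pos j with rfl | hj
    · simp
    · rw [iteratedFDeriv_const_of_ne hj.ne']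
      simp
  refine ⟨contDiff_const, fun j _ x => key j x, fun x y => ?_⟩
  have : iteratedFDeriv ℝ ⌊α⌋₊ (fun _ : E d => c) x = iteratedFDeriv ℝ ⌊α⌋₊ (fun _ : E d => c) y := by
    rcases Nat.eq_zero_or_pos ⌊α⌋₊ with h | h
    · rw [h]; ext; simp
    · rw [iteratedFDeriv_const_of_ne h.ne']; rfl
  rw [this, sub_self, norm_zero]
  positivity

/-- The rescaling `x ↦ c * Q ^ (-α) * G (Q x)` preserves Hölder bounds. -/
lemma holderBound_rescale {α M c Q : ℝ} (hα : 0 < α) (hQ : 1 ≤ Q) (hc : |c| ≤ 1) (hM : 0 ≤ M)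
    {G : E d → ℝ} (hG : ContDiff ℝ ((⌊α⌋₊ + 1 : ℕ) : WithTop ℕ∞) G)
    (hb : ∀ j : ℕ, j ≤ ⌊α⌋₊ + 1 → ∀ x, ‖iteratedFDeriv ℝ j G x‖ ≤ M) :
    HolderBound α (2 * M) (fun x => c * Q ^ (-α) * G (Q • x)) := by
  have hQ0 : 0 < Q := by linarith
  have hGj : ∀ j : ℕ, j ≤ ⌊α⌋₊ + 1 → ContDiff ℝ (j : WithTop ℕ∞) G := fun j hj =>
    hG.of_le (by exact_mod_cast hj)
  have key : ∀ j : ℕ, j ≤ ⌊α⌋₊ → ∀ x, iteratedFDeriv ℝ j (fun x => c * Q ^ (-α) * G (Q • x)) x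
      = (c * Q ^ (-α) * Q ^ j) • iteratedFDeriv ℝ j G (Q • x) := by
    intro j hj x
    have h1 := hGj j (by omega)
    have h2 : ContDiff ℝ (j : WithTop ℕ∞) (fun x => G (Q • x)) := h1.comp (contDiff_const_smul Q)
    have := iteratedFDeriv_const_smul_apply' (a := c * Q ^ (-α)) h2.contDiffAt (x := x)
    simp only [smul_eq_mul] at this
    rw [this, iteratedFDeriv_comp_const_smul Q h1, smul_smul]
  have hfl : (⌊α⌋₊ : ℝ) ≤ α := Nat.floor_le hα.le
  have hfl' : α < ⌊α⌋₊ + 1 := Nat.lt_floor_add_one α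
  have nrm : ∀ j : ℕ, ‖c * Q ^ (-α) * Q ^ j‖ ≤ Q ^ ((j : ℝ) - α) := by
    intro j
    rw [norm_mul, norm_mul, Real.norm_of_nonneg (Real.rpow_nonneg hQ0.le _),
      Real.norm_of_nonneg (pow_nonneg hQ0.le _), mul_assoc, ← Real.rpow_natCast,
      ← Real.rpow_add hQ0, neg_add_eq_sub]
    exact mul_le_of_le_one_left (Real.rpow_nonneg hQ0.le _) hc
  refine ⟨contDiff_const.mul ((hGj _ (Nat.le_succ _)).comp (contDiff_const_smul Q)),
    fun j hj x => ?_, fun x y => ?_⟩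
  · rw [key j hj, norm_smul]
    have h1 : Q ^ ((j : ℝ) - α) ≤ 1 := by
      refine Real.rpow_le_one_of_one_le_of_nonpos hQ ?_
      have : (j : ℝ) ≤ ⌊α⌋₊ := by exact_mod_cast hj
      linarith
    calc ‖c * Q ^ (-α) * Q ^ j‖ * ‖iteratedFDeriv ℝ j G (Q • x)‖
        ≤ 1 * M := mul_le_mul ((nrm j).trans h1) (hb j (by omega) _) (norm_nonneg _) zero_le_one
      _ ≤ 2 * M := by linarith
  · rw [key _ le_rfl, key _ le_rfl, ← smul_sub, norm_smul]
    set γ : ℝ := α - (⌊α⌋₊ : ℝ) with hγ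
    have hγ0 : 0 ≤ γ := by linarith
    have hγ1 : γ ≤ 1 := by linarith
    set t : ℝ := ‖Q • x - Q • y‖ with ht
    have ht' : t = Q * ‖x - y‖ := by
      rw [ht, ← smul_sub, norm_smul, Real.norm_of_nonneg hQ0.le]
    have hG2 : ‖iteratedFDeriv ℝ ⌊α⌋₊ G (Q • x) - iteratedFDeriv ℝ ⌊α⌋₊ G (Q • y)‖
        ≤ 2 * M * t ^ γ := by
      -- Small increments use the mean value inequality with the derivative of order `⌊α⌋₊ + 1`, and
      -- `t ≤ t ^ γ`; large ones use the triangle inequality, and `1 ≤ t ^ γ`.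
      rcases le_total t 1 with h | h
      · have hL : ‖iteratedFDeriv ℝ ⌊α⌋₊ G (Q • x) - iteratedFDeriv ℝ ⌊α⌋₊ G (Q • y)‖ ≤ M * t := by
          refine convex_univ.norm_image_sub_le_of_norm_fderiv_le (𝕜 := ℝ) (fun z _ => ?_)
            (fun z _ => ?_) (Set.mem_univ _) (Set.mem_univ _)
          · exact hG.contDiffAt.differentiableAt_iteratedFDeriv
              (by exact_mod_cast Nat.lt_succ_self _)
          · rw [norm_fderiv_iteratedFDeriv]
            exact hb _ le_rfl _
        have h3 : t ≤ t ^ γ := by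
          rcases eq_or_lt_of_le (norm_nonneg _ : 0 ≤ t) with h0 | h0
          · exact h0.symm.trans_le (Real.rpow_nonneg (norm_nonneg _) _)
          · simpa using Real.rpow_le_rpow_of_exponent_ge h0 h hγ1
        have h4 : 0 ≤ t := norm_nonneg _
        nlinarith
      · have h3 : 1 ≤ t ^ γ := Real.one_le_rpow h hγ0
        have h4 := norm_sub_le (iteratedFDeriv ℝ ⌊α⌋₊ G (Q • x)) (iteratedFDeriv ℝ ⌊α⌋₊ G (Q • y))
        have h5 := hb ⌊α⌋₊ (Nat.le_succ _) (Q • x)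
        have h6 := hb ⌊α⌋₊ (Nat.le_succ _) (Q • y)
        nlinarith
    calc ‖c * Q ^ (-α) * Q ^ ⌊α⌋₊‖
          * ‖iteratedFDeriv ℝ ⌊α⌋₊ G (Q • x) - iteratedFDeriv ℝ ⌊α⌋₊ G (Q • y)‖
        ≤ Q ^ (-γ) * (2 * M * t ^ γ) := by
          refine mul_le_mul ((nrm _).trans_eq ?_) hG2 (norm_nonneg _) (Real.rpow_nonneg hQ0.le _)
          rw [hγ, neg_sub]
      _ = 2 * M * ‖x - y‖ ^ γ := by
          rw [ht', Real.mul_rpow hQ0.le (norm_nonneg _), Real.rpow_neg hQ0.le]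
          have : Q ^ γ ≠ 0 := (Real.rpow_pos_of_pos hQ0 _).ne'
          field_simp

lemma prod_norm_single {n : ℕ} (f : Fin n → Fin d) :
    ∏ t, ‖(EuclideanSpace.single (f t) (1 : ℝ) : E d)‖ = 1 := by
  simp

/-- A mixed partial evaluates the multilinear derivative at unit vectors. -/
lemma abs_mixedPartial_le {s : Fin d → ℕ} {j : ℕ} (hs : s ∈ multiIndices d j) (g : E d → ℝ)
    (x : E d) : |mixedPartial s g x| ≤ ‖iteratedFDeriv ℝ j g x‖ := by
  obtain rfl : ∑ i, s i = j := (Finset.mem_piAntidiag.1 hs).1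
  have := (iteratedFDeriv ℝ (∑ i, s i) g x).le_opNorm
    (fun t => EuclideanSpace.single (finSigmaFinEquiv.symm t).1 (1 : ℝ))
  rwa [prod_norm_single, mul_one] at this

lemma abs_mixedPartial_sub_le {s : Fin d → ℕ} {j : ℕ} (hs : s ∈ multiIndices d j) (g : E d → ℝ)
    (x y : E d) : |mixedPartial s g x - mixedPartial s g y|
      ≤ ‖iteratedFDeriv ℝ j g x - iteratedFDeriv ℝ j g y‖ := by
  obtain rfl : ∑ i, s i = j := (Finset.mem_piAntidiag.1 hs).1
  have := (iteratedFDeriv ℝ (∑ i, s i) g x - iteratedFDeriv ℝ (∑ i, s i) g y).le_opNorm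
    (fun t => EuclideanSpace.single (finSigmaFinEquiv.symm t).1 (1 : ℝ))
  rwa [prod_norm_single, mul_one] at this

/-- Each sum over multi-indices has at most `card` terms bounded through `M`; adding the
cardinalities over all orders gives one constant that serves every `j`. -/
lemma HolderBound.isHolder {α M lam : ℝ} {g : E d → ℝ} (hM : 0 ≤ M)
    (h : HolderBound α M g)
    (hg : ∀ x, g x ∈ Set.Icc (0 : ℝ) 1)
    (hlam : (∑ j ∈ Finset.range (⌊α⌋₊ + 1), ((multiIndices d j).card : ℝ)) * M ≤ lam) :
    IsHolder lam α g := by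
  have hcard : ∀ j, j ≤ ⌊α⌋₊ → ((multiIndices d j).card : ℝ) * M ≤ lam := by
    intro j hj
    refine le_trans (mul_le_mul_of_nonneg_right ?_ hM) hlam
    exact Finset.single_le_sum (f := fun j => ((multiIndices d j).card : ℝ))
      (fun _ _ => Nat.cast_nonneg _) (Finset.mem_range.2 (by omega))
  refine ⟨hg, h.contDiff, fun j hj x => ?_, fun x y hxy => ?_⟩
  · have hj' : j ≤ ⌊α⌋₊ := Nat.le_floor hj
    refine le_trans (Finset.sum_le_card_nsmul _ _ M fun s hs => ?_) ?_
    · exact (abs_mixedPartial_le hs g x).trans (h.norm_le j hj' x)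
    · rw [nsmul_eq_mul]
      exact hcard j hj'
  · refine le_trans (Finset.sum_le_card_nsmul _ _ M fun s hs => ?_) ?_
    · rw [div_le_iff₀ (Real.rpow_pos_of_pos (norm_pos_iff.2 (sub_ne_zero.2 hxy)) _)]
      exact (abs_mixedPartial_sub_le hs g x y).trans (h.norm_sub_le x y)
    · rw [nsmul_eq_mul]
      exact hcard _ le_rfl

end Hoelder

/-! ### Signed sums of disjoint bumps on the integer grid -/

section Bumps

/-- A smooth bump of height `1` supported in the ball of radius `1 / 3`. -/
noncomputable def bump (d : ℕ) : ContDiffBump (0 : E d) := ⟨1 / 6, 1 / 3, by norm_num, by norm_num⟩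

lemma bump_zero : bump d 0 = 1 := (bump d).one_of_mem_closedBall (by simp [bump])

lemma bump_of_le {x : E d} (h : 1 / 3 ≤ ‖x‖) : bump d x = 0 :=
  (bump d).zero_of_le_dist (by simpa [bump] using h)

lemma iteratedFDeriv_bump_of_lt {x : E d} (h : 1 / 3 < ‖x‖) (j : ℕ) :
    iteratedFDeriv ℝ j (bump d) x = 0 := by
  by_contra hne
  have := support_iteratedFDeriv_subset (𝕜 := ℝ) (f := bump d) j hne
  rw [(bump d).tsupport_eq, Metric.mem_closedBall, dist_zero_right] at this
  simp only [bump] at this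
  linarith

lemma exists_bound_iteratedFDeriv_bump (d l : ℕ) :
    ∃ M : ℝ, 0 ≤ M ∧ ∀ j ≤ l, ∀ x, ‖iteratedFDeriv ℝ j (bump d) x‖ ≤ M := by
  have h : ∀ j : ℕ, ∃ M : ℝ, ∀ x, ‖iteratedFDeriv ℝ j (bump d) x‖ ≤ M := fun j =>
    ((bump d).hasCompactSupport.iteratedFDeriv j).exists_bound_of_continuous
      ((bump d).contDiff (n := j) |>.continuous_iteratedFDeriv le_rfl)
  choose M hM using h
  have hM0 : ∀ j, 0 ≤ M j := fun j => (norm_nonneg _).trans (hM j 0)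
  refine ⟨∑ j ∈ Finset.range (l + 1), M j, Finset.sum_nonneg fun j _ => hM0 j, fun j hj x => ?_⟩
  exact (hM j x).trans (Finset.single_le_sum (f := M) (fun j _ => hM0 j)
    (Finset.mem_range.2 (by omega)))

variable {q : ℕ}

/-- The points of `ℤ^d` with coordinates in `{0, …, q - 1}`. -/
noncomputable def gridPoint (k : Fin d → Fin q) : E d := WithLp.toLp 2 fun i => ((k i : ℕ) : ℝ)

lemma one_le_norm_gridPoint_sub {k k' : Fin d → Fin q} (h : k ≠ k') :
    1 ≤ ‖gridPoint k - gridPoint k'‖ := by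
  obtain ⟨i, hi⟩ := Function.ne_iff.1 h
  refine le_trans ?_ (PiLp.norm_apply_le (gridPoint k - gridPoint k') i)
  have : ((k i : ℕ) : ℤ) - ((k' i : ℕ) : ℤ) ≠ 0 := by
    intro h0
    apply hi
    ext
    omega
  have h1 := Int.one_le_abs this
  simp only [gridPoint, PiLp.sub_apply, Real.norm_eq_abs]
  exact_mod_cast h1

/-- Grid points are at distance at least `1 > 2 / 3`, so closed balls of radius `1 / 3` around them
are disjoint. This is why a label reveals at most one sign. The strict inequality makes the
derivatives of the other bumps vanish too. -/
lemma exists_forall_ne_lt_norm [NeZero q] (u : E d) :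
    ∃ k : Fin d → Fin q, ∀ k' ≠ k, 1 / 3 < ‖u - gridPoint k'‖ := by
  by_cases h : ∃ k : Fin d → Fin q, ‖u - gridPoint k‖ ≤ 1 / 3
  · obtain ⟨k, hk⟩ := h
    refine ⟨k, fun k' hk' => ?_⟩
    have h1 := one_le_norm_gridPoint_sub hk'
    have h2 := norm_sub_le (u - gridPoint k) (u - gridPoint k')
    rw [sub_sub_sub_cancel_left] at h2
    linarith
  · push Not at h
    exact ⟨fun _ => 0, fun k' _ => h k'⟩

/-- The sign attached to a label. -/
def sign (b : Bool) : ℝ := if b then 1 else -1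

lemma abs_sign (b : Bool) : |sign b| = 1 := by cases b <;> simp [sign]

/-- The sum of the bumps at the grid points, with signs `σ`. -/
noncomputable def bumpSum (σ : (Fin d → Fin q) → Bool) (u : E d) : ℝ :=
  ∑ k, sign (σ k) * bump d (u - gridPoint k)

lemma contDiff_bumpSum (σ : (Fin d → Fin q) → Bool) (n : ℕ) :
    ContDiff ℝ (n : WithTop ℕ∞) (bumpSum σ) := by
  unfold bumpSum
  exact ContDiff.sum fun k _ => contDiff_const.mul
    ((bump d).contDiff.comp (contDiff_id.sub contDiff_const))

lemma bumpSum_eq {k : Fin d → Fin q} {u : E d} (h : ∀ k' ≠ k, 1 / 3 ≤ ‖u - gridPoint k'‖)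
    (σ : (Fin d → Fin q) → Bool) : bumpSum σ u = sign (σ k) * bump d (u - gridPoint k) := by
  unfold bumpSum
  refine Finset.sum_eq_single k (fun k' _ hk' => ?_) (by simp)
  rw [bump_of_le (h k' hk'), mul_zero]

lemma bumpSum_gridPoint (σ : (Fin d → Fin q) → Bool) (k : Fin d → Fin q) :
    bumpSum σ (gridPoint k) = sign (σ k) := by
  rw [bumpSum_eq (k := k), sub_self, bump_zero, mul_one]
  intro k' hk'
  linarith [one_le_norm_gridPoint_sub hk'.symm]

/-- Only one bump contributes at `u`, so the bound does not grow with the number of bumps. -/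
lemma norm_iteratedFDeriv_bumpSum_le [NeZero q] {j : ℕ} {M : ℝ}
    (hM : ∀ x, ‖iteratedFDeriv ℝ j (bump d) x‖ ≤ M)
    (σ : (Fin d → Fin q) → Bool) (u : E d) : ‖iteratedFDeriv ℝ j (bumpSum σ) u‖ ≤ M := by
  obtain ⟨k, hk⟩ := exists_forall_ne_lt_norm (q := q) u
  have hc : ∀ k' : Fin d → Fin q,
      ContDiff ℝ (j : WithTop ℕ∞) (fun u => bump d (u - gridPoint k')) := fun k' =>
    (bump d).contDiff.comp (contDiff_id.sub contDiff_const)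
  have h1 : ∀ k', iteratedFDeriv ℝ j (fun u => sign (σ k') * bump d (u - gridPoint k')) u
      = sign (σ k') • iteratedFDeriv ℝ j (bump d) (u - gridPoint k') := by
    intro k'
    have := iteratedFDeriv_const_smul_apply' (a := sign (σ k')) (hc k').contDiffAt (x := u)
    simp only [smul_eq_mul] at this
    rw [this, iteratedFDeriv_comp_sub]
  have h2 : iteratedFDeriv ℝ j (bumpSum σ) u
      = sign (σ k) • iteratedFDeriv ℝ j (bump d) (u - gridPoint k) := by
    unfold bumpSum
    rw [iteratedFDeriv_fun_sum_apply fun k' _ => (contDiff_const.mul (hc k')).contDiffAt,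
      Finset.sum_eq_single k]
    · exact h1 k
    · intro k' _ hk'
      rw [h1, iteratedFDeriv_bump_of_lt (hk k' hk'), smul_zero]
    · simp
  rw [h2, norm_smul, Real.norm_eq_abs, abs_sign, one_mul]
  exact hM _

end Bumps

/-! ### The hard family of problems -/

section Construction

variable {d q : ℕ}

/-- The corner `(1, …, 1)` of the cube. -/
noncomputable def corner (d : ℕ) : E d := WithLp.toLp 2 fun _ => 1

/-- The height of the bumps. -/
noncomputable def height (α : ℝ) (q : ℕ) : ℝ := 1 / 8 * (2 * q : ℝ) ^ (-α)

/-- The regression function with sign `σ k` at the `k`-th point of the grid. -/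
noncomputable def regression (α : ℝ) (σ : (Fin d → Fin q) → Bool) (x : E d) : ℝ :=
  1 / 2 + 1 / 8 * bump d (x - corner d) + height α q * bumpSum σ ((2 * q : ℝ) • x)

/-- The points that carry the marginal: the grid, scaled into the cube, and the corner. -/
noncomputable def atom : Option (Fin d → Fin q) → E d
  | none => corner d
  | some k => (2 * q : ℝ)⁻¹ • gridPoint k

/-- The masses of the atoms. -/
noncomputable def atomMass (α β : ℝ) : Option (Fin d → Fin q) → ℝ
  | none => 1 - height α q ^ β
  | some _ => height α q ^ β / (q : ℝ) ^ d

lemma height_pos (α : ℝ) [NeZero q] : 0 < height α q := by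
  have : 0 < q := Nat.pos_of_ne_zero (NeZero.ne q)
  unfold height
  positivity

lemma one_le_two_mul_cast (q : ℕ) [NeZero q] : (1 : ℝ) ≤ 2 * q := by
  have : (1 : ℝ) ≤ q := by exact_mod_cast Nat.pos_of_ne_zero (NeZero.ne q)
  linarith

lemma height_le {α : ℝ} (hα : 0 < α) [NeZero q] : height α q ≤ 1 / 8 := by
  have := Real.rpow_le_one_of_one_le_of_nonpos (one_le_two_mul_cast q) (by linarith : -α ≤ 0)
  unfold height
  linarith

lemma height_rpow_le_one {α β : ℝ} (hα : 0 < α) (hβ : 0 ≤ β) [NeZero q] :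
    height α q ^ β ≤ 1 :=
  Real.rpow_le_one (height_pos α).le (by linarith [height_le (q := q) hα]) hβ

lemma atomMass_nonneg {α β : ℝ} (hα : 0 < α) (hβ : 0 ≤ β) [NeZero q]
    (i : Option (Fin d → Fin q)) : 0 ≤ atomMass α β i := by
  have h := height_pos (q := q) α
  have h1 := height_rpow_le_one (q := q) hα hβ
  cases i with
  | none => simpa [atomMass] using h1
  | some k => unfold atomMass; positivity

lemma sum_atomMass_some (α β : ℝ) [NeZero q] :
    ∑ k : Fin d → Fin q, atomMass α β (some k) = height α q ^ β := by
  have : (q : ℝ) ≠ 0 := by exact_mod_cast NeZero.ne q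
  simp only [atomMass, Finset.sum_const, Finset.card_univ, Fintype.card_pi, Fintype.card_fin,
    Finset.prod_const, nsmul_eq_mul, Nat.cast_pow]
  field_simp

lemma sum_atomMass (α β : ℝ) [NeZero q] :
    ∑ i : Option (Fin d → Fin q), atomMass α β i = 1 := by
  rw [Fintype.sum_option, sum_atomMass_some]
  simp [atomMass]

lemma atom_mem_unitCube [NeZero q] (i : Option (Fin d → Fin q)) : atom i ∈ unitCube d := by
  intro j
  cases i with
  | none => simp [atom, corner]
  | some k =>
    have h := one_le_two_mul_cast q
    have h1 : ((k j : ℕ) : ℝ) ≤ q := by exact_mod_cast (k j).2.le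
    simp only [atom, gridPoint, PiLp.smul_apply, smul_eq_mul]
    refine ⟨by positivity, ?_⟩
    rw [inv_mul_le_one₀ (by linarith)]
    linarith [(Nat.cast_nonneg q : (0 : ℝ) ≤ q)]

lemma contDiff_regression (α : ℝ) (σ : (Fin d → Fin q) → Bool) (n : ℕ) :
    ContDiff ℝ (n : WithTop ℕ∞) (regression α σ) := by
  unfold regression
  exact (contDiff_const.add (contDiff_const.mul
    ((bump d).contDiff.comp (contDiff_id.sub contDiff_const)))).add
      (contDiff_const.mul ((contDiff_bumpSum σ n).comp (contDiff_const_smul _)))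

/-- Only the bump nearest to `x` can be felt. The corner bump and the grid bump each move the value
by at most `1 / 8`, which keeps it in `[1/4, 3/4]`. -/
lemma exists_regression_eq {α : ℝ} (hα : 0 < α) [NeZero q] (x : E d) :
    ∃ k : Fin d → Fin q, ∃ A ∈ Set.Icc (1 / 4 : ℝ) (3 / 4), ∃ B ∈ Set.Icc (1 / 4 : ℝ) (3 / 4),
      |A - B| ≤ 2 * height α q ∧ ∀ σ, regression α σ x = if σ k then A else B := by
  obtain ⟨k, hk⟩ := exists_forall_ne_lt_norm (q := q) ((2 * q : ℝ) • x)
  set b := bump d ((2 * q : ℝ) • x - gridPoint k) with hb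
  set v := bump d (x - corner d) with hv
  have b0 : 0 ≤ b := (bump d).nonneg
  have b1 : b ≤ 1 := (bump d).le_one
  have v0 : 0 ≤ v := (bump d).nonneg
  have v1 : v ≤ 1 := (bump d).le_one
  have h0 := height_pos (q := q) α
  have h1 := height_le (q := q) hα
  have hb0 : 0 ≤ height α q * b := mul_nonneg h0.le b0
  have hb1 : height α q * b ≤ height α q := mul_le_of_le_one_right h0.le b1
  refine ⟨k, 1 / 2 + 1 / 8 * v + height α q * b, ⟨by linarith, by linarith⟩,
    1 / 2 + 1 / 8 * v - height α q * b, ⟨by linarith, by linarith⟩, ?_, fun σ => ?_⟩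
  · rw [abs_le]
    constructor <;> linarith
  · unfold regression
    rw [bumpSum_eq fun k' hk' => (hk k' hk').le]
    cases σ k <;> simp [sign, ← hb, ← hv]
    ring

lemma regression_mem {α : ℝ} (hα : 0 < α) [NeZero q] (σ : (Fin d → Fin q) → Bool) (x : E d) :
    regression α σ x ∈ Set.Icc (0 : ℝ) 1 := by
  obtain ⟨k, A, hA, B, hB, -, h⟩ := exists_regression_eq (q := q) hα x
  rw [h σ]
  split_ifs
  · exact ⟨by linarith [hA.1], by linarith [hA.2]⟩
  · exact ⟨by linarith [hB.1], by linarith [hB.2]⟩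

/-- Scaled grid points have coordinates at most `1 / 2`, hence lie at distance at least `1 / 2 > 1 /
3` from the corner, whose bump vanishes there. -/
lemma regression_atom_some (hd : 0 < d) (α : ℝ) [NeZero q] (σ : (Fin d → Fin q) → Bool)
    (k : Fin d → Fin q) :
    regression α σ (atom (some k)) = 1 / 2 + height α q * sign (σ k) := by
  have h := one_le_two_mul_cast q
  have h1 : ((k ⟨0, hd⟩ : ℕ) : ℝ) ≤ q := by exact_mod_cast (k ⟨0, hd⟩).2.le
  have h2 : (2 * q : ℝ)⁻¹ * ((k ⟨0, hd⟩ : ℕ) : ℝ) ≤ 1 / 2 := by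
    rw [inv_mul_le_iff₀ (by linarith)]
    linarith
  have h3 : bump d (atom (some k) - corner d) = 0 := by
    refine bump_of_le (le_trans ?_ (PiLp.norm_apply_le _ ⟨0, hd⟩))
    simp only [atom, corner, gridPoint, PiLp.sub_apply, PiLp.smul_apply, smul_eq_mul,
      Real.norm_eq_abs]
    rw [abs_sub_comm]
    exact le_trans (by linarith) (le_abs_self _)
  unfold regression
  rw [h3, atom, smul_inv_smul₀ (by linarith), bumpSum_gridPoint]
  ring

lemma regression_corner (hd : 0 < d) (α : ℝ) [NeZero q] (σ : (Fin d → Fin q) → Bool) :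
    regression α σ (corner d) = 5 / 8 := by
  have h : bumpSum σ ((2 * q : ℝ) • corner d) = 0 := by
    refine Finset.sum_eq_zero fun k _ => ?_
    have hq := one_le_two_mul_cast q
    have h1 : ((k ⟨0, hd⟩ : ℕ) : ℝ) ≤ q := by exact_mod_cast (k ⟨0, hd⟩).2.le
    rw [bump_of_le, mul_zero]
    refine le_trans ?_ (PiLp.norm_apply_le _ ⟨0, hd⟩)
    simp only [corner, gridPoint, PiLp.sub_apply, PiLp.smul_apply, smul_eq_mul, Real.norm_eq_abs]
    exact le_trans (by linarith) (le_abs_self _)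
  unfold regression
  rw [h, sub_self, bump_zero]
  norm_num

/-- The classification problem with signs `σ`. -/
noncomputable def signedProblem {α β : ℝ} (hα : 0 < α) (hβ : 0 ≤ β) [NeZero q]
    (σ : (Fin d → Fin q) → Bool) : Problem d where
  marginal := discreteMeasure (atomMass α β) (atom (q := q))
  isProb := isProbabilityMeasure_discreteMeasure (atomMass_nonneg hα hβ) (sum_atomMass α β) _
  supported := discreteMeasure_eq_zero _ fun i h => h (atom_mem_unitCube i)
  η := regression α σ
  measurable_η := (contDiff_regression α σ 0).continuous.measurable
  η_mem := regression_mem hα σ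

lemma abs_height_mul_sign (α : ℝ) [NeZero q] (b : Bool) :
    |height α q * sign b| = height α q := by
  rw [abs_mul, abs_sign, mul_one, abs_of_pos (height_pos α)]

/-- The distance of `η` to `1 / 2` is `1 / 8` at the corner and `height α q` at the grid atoms. For
`Δ ≥ 1 / 8` the constant `8 ^ β` suffices; between the two levels only the grid mass `height α q ^ β
≤ Δ ^ β` counts; below both there is no mass. -/
lemma signedProblem_margin (hd : 0 < d) {α β c₃ : ℝ} (hα : 0 < α) (hβ : 0 ≤ β)
    (hc : 8 ^ β ≤ c₃) [NeZero q] (σ : (Fin d → Fin q) → Bool) :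
    (signedProblem hα hβ σ).Margin β 0 c₃ := by
  have hh := height_pos (q := q) α
  have hc1 : 1 ≤ c₃ := (Real.one_le_rpow (by norm_num) hβ).trans hc
  constructor
  · convert! measure_empty (μ := (signedProblem hα hβ σ).marginal)
    ext x
    simp
  · intro Δ hΔ
    rw [zero_add]
    have hΔβ : 0 ≤ Δ ^ β := Real.rpow_nonneg hΔ.le β
    have hsome : ∀ k, |regression α σ (atom (some k)) - 1 / 2| = height α q := fun k => by
      rw [regression_atom_some hd, add_sub_cancel_left, abs_height_mul_sign]
    have hnone : |regression α σ (atom (q := q) none) - 1 / 2| = 1 / 8 := by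
      rw [atom, regression_corner hd]
      norm_num
    rcases le_or_gt (1 / 8) Δ with h | h
    · refine measureReal_le_one.trans ?_
      calc (1 : ℝ) ≤ (8 * Δ) ^ β := Real.one_le_rpow (by linarith) hβ
        _ = 8 ^ β * Δ ^ β := Real.mul_rpow (by norm_num) hΔ.le
        _ ≤ c₃ * Δ ^ β := mul_le_mul_of_nonneg_right hc hΔβ
    · change (discreteMeasure (atomMass α β) (atom (q := q))).real
        {x | |regression α σ x - 1 / 2| ≤ Δ} ≤ _
      have hnot : atom (q := q) none ∉ {x : E d | |regression α σ x - 1 / 2| ≤ Δ} := by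
        rw [Set.mem_ofPred_eq, hnone]
        linarith
      rw [discreteMeasure_real_apply (atomMass_nonneg hα hβ), Fintype.sum_option,
        Set.indicator_of_notMem hnot, mul_zero, zero_add]
      rcases le_or_gt (height α q) Δ with h' | h'
      · calc ∑ k, atomMass α β (some k)
              * Set.indicator {x | |regression α σ x - 1 / 2| ≤ Δ} 1 (atom (some k))
            ≤ ∑ k : Fin d → Fin q, atomMass α β (some k) :=
              Finset.sum_le_sum fun k _ => mul_le_of_le_one_right (atomMass_nonneg hα hβ _)
                (Set.indicator_le_self' (fun _ _ => zero_le_one) _)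
          _ = height α q ^ β := sum_atomMass_some α β
          _ ≤ Δ ^ β := Real.rpow_le_rpow hh.le h' hβ
          _ ≤ c₃ * Δ ^ β := le_mul_of_one_le_left hΔβ hc1
      · rw [Finset.sum_eq_zero]
        · positivity
        · intro k _
          rw [Set.indicator_of_notMem, mul_zero]
          rw [Set.mem_ofPred_eq, hsome]
          linarith

lemma le_excessRisk_signedProblem (hd : 0 < d) {α β : ℝ} (hα : 0 < α) (hβ : 0 ≤ β) [NeZero q]
    (σ : (Fin d → Fin q) → Bool) (f : E d → Bool) (hf : Measurable f) :
    (2 * height α q * (height α q ^ β / (q : ℝ) ^ d))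
        * ∑ k, (if f (atom (some k)) = σ k then 0 else 1)
      ≤ (signedProblem hα hβ σ).excessRisk f := by
  have hh := height_pos (q := q) α
  rw [Problem.excessRisk_eq_sum _ (atomMass_nonneg hα hβ) rfl hf, Fintype.sum_option,
    Finset.mul_sum]
  refine le_add_of_nonneg_of_le ?_ (Finset.sum_le_sum fun k _ => ?_)
  · refine mul_nonneg (atomMass_nonneg hα hβ _) ?_
    split_ifs <;> positivity
  · have hη : (signedProblem hα hβ σ).η (atom (some k)) = 1 / 2 + height α q * sign (σ k) :=
      regression_atom_some hd α σ k
    have hb : (signedProblem hα hβ σ).bayes (atom (some k)) = σ k := by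
      unfold Problem.bayes
      rw [hη]
      cases σ k <;> simp [sign, hh, hh.le]
    rw [hb, hη, add_sub_cancel_left, abs_height_mul_sign, atomMass]
    split_ifs
    · simp
    · exact le_of_eq (by ring)

/-- For a suitable Hölder constant, all the problems belong to the class. -/
lemma exists_forall_signedProblem_mem (hd : 0 < d) {α β : ℝ} (hα : 0 < α) (hβ : 0 ≤ β) :
    ∃ lam₀ : ℝ, ∀ lam c₃ : ℝ, lam₀ ≤ lam → 8 ^ β ≤ c₃ → ∀ (q : ℕ) [NeZero q]
      (σ : (Fin d → Fin q) → Bool), signedProblem hα hβ σ ∈ problemClass d α β 0 lam c₃ := by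
  obtain ⟨M, hM0, hM⟩ := exists_bound_iteratedFDeriv_bump d (⌊α⌋₊ + 1)
  refine ⟨(∑ j ∈ Finset.range (⌊α⌋₊ + 1), ((multiIndices d j).card : ℝ))
    * (|1 / 2| + 2 * M + 2 * M), fun lam c₃ hlam hc q _ σ =>
      ⟨HolderBound.isHolder (by positivity) ?_ (regression_mem hα σ) hlam,
        signedProblem_margin hd hα hβ hc σ⟩⟩
  refine (holderBound_const.add ?_).add ?_
  -- The corner bump is the case `Q = 1` of the rescaling.
  · have := holderBound_rescale (c := 1 / 8) hα le_rfl (by norm_num [abs_of_pos]) hM0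
      (G := fun x : E d => bump d (x - corner d))
      ((bump d).contDiff.comp (contDiff_id.sub contDiff_const))
      (fun j hj x => by rw [iteratedFDeriv_comp_sub]; exact hM j hj _)
    simpa using this
  · exact holderBound_rescale hα (one_le_two_mul_cast q) (by norm_num [abs_of_pos]) hM0
      (contDiff_bumpSum σ _) (fun j hj x => norm_iteratedFDeriv_bumpSum_le (hM j hj) σ x)

/-- With at most `q ^ (2 * α + d)` labels, the signs cannot be learned. -/
lemma Strategy.height_rpow_le (hd : 0 < d) {α β b : ℝ} (hα : 0 < α) (hβ : 0 ≤ β) [NeZero q]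
    {Ω : Type*} [MeasurableSpace Ω] (S : Strategy d Ω) {n : ℕ} (hS : S.HasBudget n)
    (hn : (n : ℝ) ≤ (q : ℝ) ^ (2 * α + d))
    (hb : ∀ σ : (Fin d → Fin q) → Bool, S.expectedExcessRisk (signedProblem hα hβ σ) ≤ b) :
    1 / 4 * height α q ^ (1 + β) ≤ b := by
  have hh := height_pos (q := q) α
  have hq : (0 : ℝ) < q := by exact_mod_cast Nat.pos_of_ne_zero (NeZero.ne q)
  have hqd : (0 : ℝ) < (q : ℝ) ^ d := by positivity
  refine le_trans ?_ (S.le_of_forall_expectedExcessRisk_le hS (signedProblem hα hβ)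
    (c := 2 * height α q * (height α q ^ β / (q : ℝ) ^ d)) (δ := 2 * height α q) (by positivity)
    (fun k => atom (some k)) _ (fun σ => rfl) (exists_regression_eq hα)
    (le_excessRisk_signedProblem hd hα hβ) hb)
  have hinfo : n * height α q ^ 2 ≤ (q : ℝ) ^ d / 64 := by
    have h1 : ((2 * q : ℝ) ^ (-α)) ^ 2 ≤ (q : ℝ) ^ (-(2 * α)) := by
      rw [← Real.rpow_natCast, ← Real.rpow_mul (by positivity)]
      have h2 := Real.rpow_le_rpow_of_nonpos hq (by linarith : (q : ℝ) ≤ 2 * q)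
        (by linarith : -(2 * α) ≤ 0)
      convert! h2 using 2
      push_cast
      ring
    have h3 : (q : ℝ) ^ (2 * α + d) * (q : ℝ) ^ (-(2 * α)) = (q : ℝ) ^ d := by
      rw [← Real.rpow_add hq, ← Real.rpow_natCast]
      congr 1
      ring
    calc n * height α q ^ 2 = n * ((2 * q : ℝ) ^ (-α)) ^ 2 / 64 := by unfold height; ring
      _ ≤ (q : ℝ) ^ (2 * α + d) * (q : ℝ) ^ (-(2 * α)) / 64 := by gcongr
      _ = (q : ℝ) ^ d / 64 := by rw [h3]
  have hcard : (Fintype.card (Fin d → Fin q) : ℝ) = (q : ℝ) ^ d := by simp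
  rw [hcard]
  calc 1 / 4 * height α q ^ (1 + β)
      = 2 * height α q * (height α q ^ β / (q : ℝ) ^ d) * ((q : ℝ) ^ d / 8) := by
        rw [Real.rpow_add hh, Real.rpow_one]
        field_simp
        norm_num
    _ ≤ _ := by
        refine mul_le_mul_of_nonneg_left ?_ (by positivity)
        -- With `δ = 2 * height α q`, `hinfo` bounds the total loss of potential by `q ^ d / 48`,
        -- and `1 / 4 - 1 / 48 ≥ 1 / 8`.
        nlinarith

end Construction

end ActiveLearning

/-! ### Choice of the grid size and conclusion -/

theorem mainTheorem4 (d : ℕ) (hd : 0 < d) (α β : ℝ) (hα : 0 < α) (hβ : 0 ≤ β) :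
    ∃ c₀ lam₀ : ℝ, ∀ c₃ lam : ℝ, c₀ ≤ c₃ → lam₀ ≤ lam →
      ∃ C : ℝ, 0 < C ∧ ∃ N : ℕ, ∀ n : ℕ, N ≤ n →
        ∀ (Ω : Type*) [MeasurableSpace Ω] (S : ActiveLearning.Strategy d Ω), S.HasBudget n →
          C * (n : ℝ) ^ (-(α * (1 + β) / (2 * α + d))) ≤
            ⨆ P : ActiveLearning.problemClass d α β 0 lam c₃, S.expectedExcessRisk P.1 := by
  obtain ⟨lam₀, hmem⟩ := ActiveLearning.exists_forall_signedProblem_mem hd hα hβ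
  -- In `C`, the factor `4 ^ (-(α * (1 + β)))` comes from `2 * q ≤ 4 * r`, and `1 / 8` from the
  -- definition of `height`.
  refine ⟨8 ^ β, lam₀, fun c₃ lam hc hlam =>
    ⟨1 / 4 * ((1 / 8) ^ (1 + β) * 4 ^ (-(α * (1 + β)))), by positivity, 1, ?_⟩⟩
  intro n hn Ω _ S hS
  have hn1 : (1 : ℝ) ≤ n := by exact_mod_cast hn
  have hs : 0 < 2 * α + d := by positivity
  set r : ℝ := (n : ℝ) ^ (1 / (2 * α + d)) with hr
  have hr1 : 1 ≤ r := Real.one_le_rpow hn1 (by positivity)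
  set q : ℕ := ⌈r⌉₊ with hq
  have hq0 : 0 < q := Nat.ceil_pos.2 (by linarith)
  have : NeZero q := ⟨hq0.ne'⟩
  have hrq : r ≤ q := Nat.le_ceil r
  have hqr : (q : ℝ) ≤ 2 * r := by
    have := Nat.ceil_lt_add_one (by linarith : 0 ≤ r)
    rw [← hq] at this
    linarith
  have hnq : (n : ℝ) ≤ (q : ℝ) ^ (2 * α + d) := by
    calc (n : ℝ) = r ^ (2 * α + d) := by
          rw [hr, ← Real.rpow_mul (by linarith), one_div_mul_cancel hs.ne', Real.rpow_one]
      _ ≤ (q : ℝ) ^ (2 * α + d) := Real.rpow_le_rpow (by linarith) hrq hs.le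
  -- A real supremum over an unbounded family would take the default value `0`, so boundedness is
  -- needed to compare with it.
  have hbdd : BddAbove (Set.range fun P : ActiveLearning.problemClass d α β 0 lam c₃ =>
      S.expectedExcessRisk P.1) := by
    refine ⟨1, ?_⟩
    rintro _ ⟨P, rfl⟩
    exact S.expectedExcessRisk_le_one P.1
  refine le_trans ?_ (S.height_rpow_le hd hα hβ hS hnq fun σ =>
    le_ciSup hbdd ⟨_, hmem lam c₃ hlam hc q σ⟩)
  rw [mul_assoc]
  refine mul_le_mul_of_nonneg_left ?_ (by norm_num)
  have hexp : -(α * (1 + β)) ≤ 0 := by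
    have := mul_pos hα (by linarith : 0 < 1 + β)
    linarith
  calc (1 / 8 : ℝ) ^ (1 + β) * 4 ^ (-(α * (1 + β))) * (n : ℝ) ^ (-(α * (1 + β) / (2 * α + d)))
      = (1 / 8 : ℝ) ^ (1 + β) * (4 * r) ^ (-(α * (1 + β))) := by
        rw [Real.mul_rpow (by norm_num) (by linarith), hr, ← Real.rpow_mul (by linarith), mul_assoc]
        congr 3
        ring
    _ ≤ (1 / 8 : ℝ) ^ (1 + β) * (2 * q : ℝ) ^ (-(α * (1 + β))) := by
        refine mul_le_mul_of_nonneg_left ?_ (by positivity)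
        exact Real.rpow_le_rpow_of_nonpos (by positivity) (by linarith) hexp
    _ = ActiveLearning.height α q ^ (1 + β) := by
        unfold ActiveLearning.height
        rw [Real.mul_rpow (x := 1 / 8) (by norm_num) (by positivity),
          ← Real.rpow_mul (by positivity), neg_mul]
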